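/- Let $G$ be a finite connected chordal graph with vertex set $V$, and let $\mathcal C$ be the set of its (inclusion-)maximal cliques. A clique tree for $G$ is a tree $T$ with node set $\mathcal C$ such that for all $C_1, C_2 \in \mathcal C$ and every $C_3 \in \mathcal C$ on the path in $T$ between $C_1$ and $C_2$ one has $C_1 \cap C_2 \subseteq C_3$. A vertex is simplicial if its set of neighbours is a clique. For $C \in \mathcal C$ let $\mathrm{Simp}(C)$ and $\mathrm{Sep}(C)$ be the sets of simplicial and of non-simplicial vertices of $G$ lying in $C$; the maximal clique $C$ is called simply separated (a boundary clique) if $\mathrm{Simp}(C) \neq \emptyset$ and there is a $C' \in \mathcal C$ with $\mathrm{Sep}(C) = C \cap C'$. Suppose that $G$ has exactly one clique tree $T$. Then every simply separated maximal clique of $G$ is an endpoint of $T$, that is, a node with exactly one neighbour in $T$. -/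

import Mathlib

namespace CliqueTrees

variable {V : Type*}

/-- `G` is chordal: every cycle of length at least four has a chord, i.e. an edge of `G` joining
two vertices of the cycle that is not an edge of the cycle. -/
def IsChordal (G : SimpleGraph V) : Prop :=
  ∀ (v : V) (c : G.Walk v v), c.IsCycle → 4 ≤ c.length →
    ∃ x ∈ c.support, ∃ y ∈ c.support, G.Adj x y ∧ s(x, y) ∉ c.edges

/-- The type of maximal cliques of `G` (maximal with respect to inclusion). -/
abbrev MaxClique (G : SimpleGraph V) : Type _ :=
  {C : Set V // Maximal (fun s : Set V => G.IsClique s) C}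

/-- `T` is a clique tree for `G`: a tree on the maximal cliques of `G` with the junction property,
i.e. every `C₃` on the path of `T` between `C₁` and `C₂` contains `C₁ ∩ C₂`. -/
structure IsCliqueTree (G : SimpleGraph V) (T : SimpleGraph (MaxClique G)) : Prop where
  isTree : T.IsTree
  junction : ∀ (C₁ C₂ : MaxClique G) (p : T.Walk C₁ C₂), p.IsPath →
    ∀ C₃ ∈ p.support, C₁.1 ∩ C₂.1 ⊆ C₃.1

/-- `T` is the unique clique tree for `G`. -/
def IsUniqueCliqueTree (G : SimpleGraph V) (T : SimpleGraph (MaxClique G)) : Prop :=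
  IsCliqueTree G T ∧ ∀ T' : SimpleGraph (MaxClique G), IsCliqueTree G T' → T' = T

/-- A vertex is simplicial if its open neighbourhood is a clique. -/
def IsSimplicialVertex (G : SimpleGraph V) (v : V) : Prop :=
  G.IsClique (G.neighborSet v)

/-- The simplicial component of `C`: its simplicial vertices. -/
def simp (G : SimpleGraph V) (C : MaxClique G) : Set V :=
  {v | v ∈ C.1 ∧ IsSimplicialVertex G v}

/-- The non-simplicial component of `C`: its non-simplicial vertices. -/
def sep (G : SimpleGraph V) (C : MaxClique G) : Set V :=
  {v | v ∈ C.1 ∧ ¬ IsSimplicialVertex G v}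

/-- A maximal clique `C` is simply separated (a boundary clique) if it contains a simplicial
vertex and `sep G C = C ∩ C'` for some maximal clique `C'`. -/
def IsSimplySeparated (G : SimpleGraph V) (C : MaxClique G) : Prop :=
  (simp G C).Nonempty ∧ ∃ C' : MaxClique G, sep G C = C.1 ∩ C'.1

/-- A node of a tree is an endpoint if it has exactly one neighbour. -/
def IsEndpoint {W : Type*} (T : SimpleGraph W) (w : W) : Prop :=
  ∃! u, T.Adj w u

end CliqueTrees

namespace CliqueTrees

variable {V : Type*} {G : SimpleGraph V}

/-! The junction property along the path from `C` to `C'` gives a neighbour `E` of `C` containing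
`sep G C`. If `D` were another neighbour, then `C ∩ D ⊆ sep G C ⊆ E`, so replacing the edge `CD` by
`ED` would give a second clique tree, against uniqueness. -/

/-- A maximal clique containing a simplicial vertex is the closed neighbourhood of that vertex. -/
theorem IsSimplicialVertex.eq_insert_neighborSet {v : V} (hv : IsSimplicialVertex G v)
    (C : MaxClique G) (hvC : v ∈ C.1) : C.1 = insert v (G.neighborSet v) := by
  have hclique : G.IsClique (insert v (G.neighborSet v)) :=
    SimpleGraph.IsClique.insert hv fun _ hb _ => hb
  refine C.2.eq_of_le hclique fun w hw => ?_
  by_cases h : w = v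
  · exact Or.inl h
  · exact Or.inr (C.2.prop hvC hw (Ne.symm h))

/-- A simplicial vertex lies in only one maximal clique, its closed neighbourhood. -/
theorem inter_subset_sep {C D : MaxClique G} (hCD : D ≠ C) : C.1 ∩ D.1 ⊆ sep G C :=
  fun _ hv => ⟨hv.1, fun hs => hCD <| Subtype.ext <|
    (hs.eq_insert_neighborSet D hv.2).trans (hs.eq_insert_neighborSet C hv.1).symm⟩

/-- The junction property only needs to be witnessed by walks in the tree. -/
theorem isCliqueTree_of_forall_exists_walk {T : SimpleGraph (MaxClique G)} (hT : T.IsTree)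
    (h : ∀ C₁ C₂ : MaxClique G, ∃ p : T.Walk C₁ C₂, ∀ D ∈ p.support, C₁.1 ∩ C₂.1 ⊆ D.1) :
    IsCliqueTree G T where
  isTree := hT
  junction C₁ C₂ p hp D hD := by
    classical
    obtain ⟨q, hq⟩ := h C₁ C₂
    have hpq : p = q.bypass :=
      congrArg Subtype.val ((hT.isAcyclic.subsingleton_path C₁ C₂).elim ⟨p, hp⟩ ⟨q.bypass, q.bypass_isPath⟩)
    subst hpq
    exact hq D (q.support_bypass_subset_support hD)

/-- The graph obtained from `T` by replacing the edge between `c` and `d` by one between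
`e` and `d`. -/
def swapEdge {W : Type*} (T : SimpleGraph W) (c d e : W) : SimpleGraph W :=
  T.deleteEdges {s(c, d)} ⊔ SimpleGraph.edge e d

/-- Deleting the bridge `cd` leaves `e` joined to `c`, so the new edge `ed` links two distinct
components and closes no cycle. -/
theorem swapEdge_isAcyclic {W : Type*} {T : SimpleGraph W} {c d e : W} (hT : T.IsAcyclic)
    (hcd : T.Adj c d) (hce : T.Adj c e) (hed : e ≠ d) : (swapEdge T c d e).IsAcyclic := by
  refine SimpleGraph.IsAcyclic.sup_edge_of_not_reachable (fun hr => ?_)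
    (hT.anti (SimpleGraph.deleteEdges_le _))
  have hbridge := SimpleGraph.isBridge_iff.1
    (SimpleGraph.isAcyclic_iff_forall_adj_isBridge.1 hT hcd)
  have hadj : (T.deleteEdges {s(c, d)}).Adj c e := by
    rw [SimpleGraph.deleteEdges_adj]
    refine ⟨hce, fun h => hed ?_⟩
    exact Sym2.congr_right.1 h
  exact hbridge (hadj.reachable.trans hr)

/-- A walk in `T` yields a walk in `swapEdge T c d e` whose nodes all satisfy `P`, if the nodes of
the original walk do and `P` passes from `c` and `d` to `e`. -/
theorem exists_walk_swapEdge {W : Type*} {T : SimpleGraph W} {c d e : W}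
    (hcd : T.Adj c d) (hce : T.Adj c e) (hed : e ≠ d) {P : W → Prop} (hP : P c → P d → P e)
    {a b : W} (p : T.Walk a b) (hp : ∀ x ∈ p.support, P x) :
    ∃ q : (swapEdge T c d e).Walk a b, ∀ x ∈ q.support, P x := by
  have hce' : (swapEdge T c d e).Adj c e := by
    refine Or.inl (SimpleGraph.deleteEdges_adj.2 ⟨hce, fun h => hed ?_⟩)
    exact Sym2.congr_right.1 h
  have hed' : (swapEdge T c d e).Adj e d :=
    Or.inr ((SimpleGraph.edge_adj _ _ _ _).2 ⟨Or.inl ⟨rfl, rfl⟩, hed⟩)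
  induction p with
  | nil => exact ⟨.nil, by simpa using hp⟩
  | @cons a m b h p ih =>
    obtain ⟨q, hq⟩ := ih fun x hx => hp x (by simp [hx])
    have ha : P a := hp a (by simp)
    have hm : P m := hq m (by simp)
    by_cases hs : s(a, m) = s(c, d)
    · rcases Sym2.eq_iff.1 hs with ⟨rfl, rfl⟩ | ⟨rfl, rfl⟩
      · exact ⟨.cons hce' (.cons hed' q), by simpa using ⟨ha, hP ha hm, hq⟩⟩
      · exact ⟨.cons hed'.symm (.cons hce'.symm q), by simpa using ⟨ha, hP hm ha, hq⟩⟩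
    · have hadj : (swapEdge T c d e).Adj a m := Or.inl (SimpleGraph.deleteEdges_adj.2 ⟨h, hs⟩)
      exact ⟨.cons hadj q, by simpa using ⟨ha, hq⟩⟩

/-- Paths that used `CD` detour through `E`; a set inside both `C` and `D` lies in `E`, so the
junction property survives. -/
theorem IsCliqueTree.swapEdge {T : SimpleGraph (MaxClique G)} (hT : IsCliqueTree G T)
    {C D E : MaxClique G} (hCD : T.Adj C D) (hCE : T.Adj C E) (hED : E ≠ D)
    (hsub : C.1 ∩ D.1 ⊆ E.1) : IsCliqueTree G (swapEdge T C D E) := by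
  have hwalk (C₁ C₂ : MaxClique G) : ∃ q : (CliqueTrees.swapEdge T C D E).Walk C₁ C₂,
      ∀ X ∈ q.support, C₁.1 ∩ C₂.1 ⊆ X.1 := by
    obtain ⟨p, hp⟩ := hT.isTree.connected.preconnected.exists_isPath C₁ C₂
    exact exists_walk_swapEdge hCD hCE hED (P := fun X => C₁.1 ∩ C₂.1 ⊆ X.1)
      (fun h₁ h₂ => (Set.subset_inter h₁ h₂).trans hsub) p (hT.junction C₁ C₂ p hp)
  have : Nonempty (MaxClique G) := ⟨C⟩
  exact isCliqueTree_of_forall_exists_walk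
    ⟨⟨fun C₁ C₂ => (hwalk C₁ C₂).nonempty⟩, swapEdge_isAcyclic hT.isTree.isAcyclic hCD hCE hED⟩
    hwalk

/-- The separator of a simply separated clique is contained in one of its neighbours. -/
theorem IsCliqueTree.exists_adj_sep_subset {T : SimpleGraph (MaxClique G)} (hT : IsCliqueTree G T)
    {C : MaxClique G} (hC : IsSimplySeparated G C) : ∃ E, T.Adj C E ∧ sep G C ⊆ E.1 := by
  obtain ⟨⟨v, hv⟩, C', hC'⟩ := hC
  obtain ⟨p, hp⟩ := hT.isTree.connected.preconnected.exists_isPath C C'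
  cases p with
  -- Here `C' = C`, so `sep G C` is all of `C`, leaving no room for the simplicial `v`.
  | nil =>
    have hmem : v ∈ sep G C := hC' ▸ ⟨hv.1, hv.1⟩
    exact absurd hv.2 hmem.2
  | @cons _ E _ h p =>
    exact ⟨E, h, hC' ▸ hT.junction C C' _ hp E (by simp)⟩

end CliqueTrees

theorem mainTheorem7 {V : Type*} [Finite V] (G : SimpleGraph V) (hconn : G.Connected)
    (hchordal : CliqueTrees.IsChordal G) (T : SimpleGraph (CliqueTrees.MaxClique G))
    (hT : CliqueTrees.IsUniqueCliqueTree G T) (C : CliqueTrees.MaxClique G)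
    (hC : CliqueTrees.IsSimplySeparated G C) :
    CliqueTrees.IsEndpoint T C := by
  obtain ⟨E, hCE, hsep⟩ := hT.1.exists_adj_sep_subset hC
  refine ⟨E, hCE, fun D hCD => ?_⟩
  by_contra hDE
  have hED : E ≠ D := Ne.symm hDE
  have heq := hT.2 _ (hT.1.swapEdge hCD hCE hED
    ((CliqueTrees.inter_subset_sep hCD.ne').trans hsep))
  have hadj : (CliqueTrees.swapEdge T C D E).Adj C D := heq.symm ▸ hCD
  -- `CD` was deleted, and the added edge `ED` avoids `C`.
  rcases hadj with h | h
  · exact (SimpleGraph.deleteEdges_adj.1 h).2 rfl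
  · rcases ((SimpleGraph.edge_adj _ _ _ _).1 h).1 with h | h
    · exact hCE.ne h.1
    · exact hCD.ne h.1
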